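/- Let $F$ be a finite field with $q$ elements and let $G=\mathrm{GL}_4(F)$. For $1\le k\le 3$ if $\mathrm{char}(F)\ne 2$, let $X_k$ be the conjugacy class in $G$ of the diagonal matrix $\mathrm{diag}(1,\dots,1,-1,\dots,-1)$ with $4-k$ entries $1$ followed by $k$ entries $-1$; if $\mathrm{char}(F)=2$, let $X_1$ be the conjugacy class in $G$ of $I_4+e_{43}$, where $I_4$ is the identity matrix and $e_{43}$ is the matrix with a one in position $(4,3)$ and zeros elsewhere. Let $\Gamma(G,X_k)$ be the graph with vertex set $X_k$ in which two distinct elements $x,y$ are adjacent if and only if $xy=yx$, let $d$ be its graph distance, and for $t\in X_k$ put $\Delta_i(t)=\{x\in X_k \mid d(t,x)=i\}$. Let $k\in\{1,3\}$ if $\mathrm{char}(F)\neq 2$ and $k=1$ if $\mathrm{char}(F)=2$. Then $\Gamma(G,X_k)$ is connected of diameter $2$. Moreover, for every $t\in X_k$, $$|\Delta_1(t)|=\begin{cases} q^4+2q^3-q^2-q-2 & \text{if } \mathrm{char}(F)=2,\\ q^4+q^3+q^2 & \text{if } \mathrm{char}(F)\neq 2,\end{cases}$$ $$|\Delta_2(t)|=\begin{cases}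 q^6+q^5-2q^3 & \text{if } \mathrm{char}(F)=2,\\ q^6+q^5-q^2-1 & \text{if } \mathrm{char}(F)\neq 2.\end{cases}$$ -/

import Mathlib

/-- The commuting graph `Γ(G, X)`: its vertices are the elements of `X`, and two distinct
vertices are joined when they commute in `G`. -/
def commutingGraph {G : Type*} [Group G] (X : Set G) : SimpleGraph X where
  Adj x y := x ≠ y ∧ (x : G) * y = y * x
  symm := ⟨fun _ _ h => ⟨h.1.symm, h.2.symm⟩⟩
  loopless := ⟨fun _ h => h.1 rfl⟩

/-- The sphere `Δ_i(t)`: the vertices of `Γ(G, X)` at distance `i` from `t`. -/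
def distanceSphere {G : Type*} [Group G] {X : Set G} (t : X) (i : ℕ) : Set X :=
  {x | (commutingGraph X).edist t x = i}

/-- The standard matrix `I(n, k)`, with rows and columns numbered from `0`. In characteristic
different from `2` it is the diagonal matrix with `n - k` entries `1` followed by `k` entries `-1`.
In characteristic `2` (with `2 k ≤ n`) it is the identity matrix plus a block `I_k` in the
last `k` rows and in the columns `n - 2 k, …, n - k - 1`. -/
noncomputable def involutionMatrix (F : Type*) [Field F] (n k : ℕ) : Matrix (Fin n) (Fin n) F :=
  if ringChar F = 2 then
    Matrix.of fun i j =>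
      if i = j then 1 else if n - k ≤ (i : ℕ) ∧ (j : ℕ) + k = i then 1 else 0
  else
    Matrix.diagonal fun i => if (i : ℕ) < n - k then 1 else -1

theorem involutionMatrix_det_ne_zero (F : Type*) [Field F] (n k : ℕ) :
    (involutionMatrix F n k).det ≠ 0 := by
  unfold involutionMatrix
  split_ifs with h
  · rw [Matrix.det_of_isLowerTriangular]
    · simp
    · intro i j hij
      have h1 : (i : ℕ) < j := by simpa using hij
      have h2 : i ≠ j := by rintro rfl; omega
      have h3 : ¬ (n - k ≤ (i : ℕ) ∧ (j : ℕ) + k = i) := by omega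
      rw [Matrix.of_apply, if_neg h2, if_neg h3]
  · rw [Matrix.det_diagonal, Finset.prod_ne_zero_iff]
    intro i _
    split_ifs <;> simp

/-- `I(n, k)` as an element of `GL_n(F)`. -/
noncomputable def standardInvolution (F : Type*) [Field F] (n k : ℕ) : GL (Fin n) F :=
  Matrix.GeneralLinearGroup.mkOfDetNeZero (involutionMatrix F n k)
    (involutionMatrix_det_ne_zero F n k)

/-- The class `X_k`: the conjugacy class of `I(n, k)` in `GL_n(F)`. -/
def involutionClass (F : Type*) [Field F] (n k : ℕ) : Set (GL (Fin n) F) :=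
  {x | IsConj (standardInvolution F n k) x}

/-! ### Distances when any two vertices have a common neighbour -/

section CommutingGraph

variable {G : Type*} [Group G] {X : Set G}

/-! Up to a common scalar ε = ±1, every element of the class is a rank-one perturbation 1 + vφᵀ of
the identity with v, φ nonzero and v·φ = -2: a reflection in odd characteristic, a transvection in
characteristic 2. Conversely all such matrices occur, since GL is transitive on these pairs
(`coe_image_conjClass`). Two of them, from (v, φ) and (w, ψ), commute exactly when they are equal or
w·φ = v·ψ = 0 (`rankOneUpdate_mul_comm_iff`).

The graph thus becomes linear algebra. In dimension 4 any two pairs are orthogonal to a third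
(`exists_orthogonal_involutionPair`), so all distances are at most 2 and Δ₂(t) consists of the
elements not commuting with t. For the sizes, count pairs instead of matrices: each matrix arises
from the q - 1 pairs (av, a⁻¹φ). Counting all pairs gives |X|, counting pairs orthogonal to a fixed
one gives |Δ₁|, and |Δ₂| is what remains; it is positive, so the diameter is exactly 2. -/

theorem commutingGraph_edist_le_two
    (hX : ∀ x ∈ X, ∀ y ∈ X, ¬ Commute x y → ∃ z ∈ X, Commute x z ∧ Commute z y) (x y : X) :
    (commutingGraph X).edist x y ≤ 2 := by
  by_cases hxy : x = y
  · subst hxy; simp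
  by_cases hc : Commute (x : G) y
  · have h : (commutingGraph X).Adj x y := ⟨hxy, hc⟩
    rw [SimpleGraph.edist_eq_one_iff_adj.2 h]
    norm_num
  · obtain ⟨z, hz, hxz, hzy⟩ := hX x x.2 y y.2 hc
    have h1 : (commutingGraph X).Adj x ⟨z, hz⟩ :=
      ⟨fun h => hc (by rw [h]; exact hzy), hxz⟩
    have h2 : (commutingGraph X).Adj ⟨z, hz⟩ y :=
      ⟨fun h => hc (by rw [← h]; exact hxz), hzy⟩
    exact SimpleGraph.edist_le (SimpleGraph.Walk.cons h1 (SimpleGraph.Walk.cons h2 .nil))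

theorem distanceSphere_one (t : X) :
    distanceSphere t 1 = {x : X | Commute (t : G) x} \ {t} := by
  ext x
  have h : x ∈ distanceSphere t 1 ↔ (commutingGraph X).Adj t x := by
    rw [← SimpleGraph.edist_eq_one_iff_adj]; simp [distanceSphere]
  rw [h]
  exact ⟨fun h => ⟨h.2, fun e => h.1 e.symm⟩, fun h => ⟨fun e => h.2 e.symm, h.1⟩⟩

theorem distanceSphere_two
    (hX : ∀ x ∈ X, ∀ y ∈ X, ¬ Commute x y → ∃ z ∈ X, Commute x z ∧ Commute z y) (t : X) :
    distanceSphere t 2 = {x : X | Commute (t : G) x}ᶜ := by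
  ext x
  simp only [distanceSphere, Set.mem_ofPred_eq, Set.mem_compl_iff, Nat.cast_ofNat]
  refine ⟨fun h hc => ?_, fun hc => ?_⟩
  · by_cases htx : t = x
    · subst htx; simp at h
    · rw [SimpleGraph.edist_eq_one_iff_adj.2 (⟨htx, hc⟩ : (commutingGraph X).Adj t x)] at h
      norm_num at h
  · have hle := commutingGraph_edist_le_two hX t x
    have h0 : (commutingGraph X).edist t x ≠ 0 := fun h => hc (by
      rw [SimpleGraph.edist_eq_zero_iff.1 h])
    have h1 : (commutingGraph X).edist t x ≠ 1 := fun h =>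
      hc (SimpleGraph.edist_eq_one_iff_adj.1 h).2
    refine le_antisymm hle ?_
    have h3 : 1 < (commutingGraph X).edist t x :=
      lt_of_le_of_ne (Order.one_le_iff_ne_zero.2 h0) h1.symm
    have := Order.add_one_le_of_lt h3
    rwa [one_add_one_eq_two] at this

theorem commutingGraph_connected [Nonempty X]
    (hX : ∀ x ∈ X, ∀ y ∈ X, ¬ Commute x y → ∃ z ∈ X, Commute x z ∧ Commute z y) :
    (commutingGraph X).Connected := by
  refine ⟨fun x y => ?_⟩
  rw [← SimpleGraph.edist_ne_top_iff_reachable]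
  exact ne_top_of_le_ne_top (by simp) (commutingGraph_edist_le_two hX x y)

theorem commutingGraph_ediam_eq_two
    (hX : ∀ x ∈ X, ∀ y ∈ X, ¬ Commute x y → ∃ z ∈ X, Commute x z ∧ Commute z y)
    {t : X} (ht : (distanceSphere t 2).Nonempty) : (commutingGraph X).ediam = 2 := by
  refine le_antisymm (SimpleGraph.ediam_le_of_edist_le (commutingGraph_edist_le_two hX)) ?_
  obtain ⟨x, hx⟩ := ht
  exact (hx : (commutingGraph X).edist t x = 2).symm.le.trans SimpleGraph.edist_le_ediam

end CommutingGraph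

/-! ### Reflections and transvections as rank-one updates, and when they commute -/

section RankOne

open Matrix

variable {F : Type*} [Field F] {n : ℕ}

theorem two_eq_zero_iff_ringChar : (2 : F) = 0 ↔ ringChar F = 2 := by
  refine ⟨fun h => ?_, fun h => ?_⟩
  · by_contra h'
    exact Ring.two_ne_zero h' h
  · have := ringChar.Nat.cast_ringChar (R := F)
    rw [h] at this
    exact_mod_cast this

/-- Two hyperplanes never cover the space, over any field; a vector off both is rescaled. -/
theorem exists_dotProduct_eq_one_and_ne_zero {x y : Fin n → F} (hx : x ≠ 0) (hy : y ≠ 0) :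
    ∃ u : Fin n → F, x ⬝ᵥ u = 1 ∧ y ⬝ᵥ u ≠ 0 := by
  have key : ∃ u : Fin n → F, x ⬝ᵥ u ≠ 0 ∧ y ⬝ᵥ u ≠ 0 := by
    obtain ⟨i, hi⟩ := Function.ne_iff.1 hx
    obtain ⟨j, hj⟩ := Function.ne_iff.1 hy
    simp only [Pi.zero_apply] at hi hj
    by_cases h1 : y i = 0
    · by_cases h2 : x j = 0
      · exact ⟨Pi.single i 1 + Pi.single j 1, by simp [dotProduct_add, h2, hi],
          by simp [dotProduct_add, h1, hj]⟩
      · exact ⟨Pi.single j 1, by simp [h2], by simp [hj]⟩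
    · exact ⟨Pi.single i 1, by simp [hi], by simp [h1]⟩
  obtain ⟨u, h1, h2⟩ := key
  exact ⟨(x ⬝ᵥ u)⁻¹ • u, by simp [h1], by simp [h1, h2]⟩

theorem det_one_add_vecMulVec (v φ : Fin n → F) : (1 + vecMulVec v φ).det = 1 + φ ⬝ᵥ v := by
  rw [vecMulVec_eq Unit, det_one_add_replicateCol_mul_replicateRow]

/-- The general linear group is transitive on the pairs of a nonzero vector and a nonzero covector
with a given pairing. -/
theorem exists_mulVec_eq_and_vecMul_eq {v w φ ψ : Fin n → F} (hv : v ≠ 0) (hw : w ≠ 0)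
    (hφ : φ ≠ 0) (hψ : ψ ≠ 0) (h : v ⬝ᵥ φ = w ⬝ᵥ ψ) :
    ∃ g : GL (Fin n) F, (g : Matrix (Fin n) (Fin n) F) *ᵥ v = w ∧
      ψ ᵥ* (g : Matrix (Fin n) (Fin n) F) = φ := by
  obtain ⟨χ, hχv, hχw⟩ := exists_dotProduct_eq_one_and_ne_zero hv hw
  -- As χ·v = 1, this sends v to w, and its determinant is χ·w ≠ 0. It remains to correct the
  -- covector without moving v.
  set g₁ : Matrix (Fin n) (Fin n) F := 1 + vecMulVec (w - v) χ with hg₁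
  have hd₁ : g₁.det ≠ 0 := by
    rw [det_one_add_vecMulVec, dotProduct_sub, dotProduct_comm χ v, hχv, dotProduct_comm]
    simpa using hχw
  have hg₁v : g₁ *ᵥ v = w := by
    rw [hg₁, add_mulVec, one_mulVec, vecMulVec_mulVec, dotProduct_comm, hχv]
    simp
  set θ := ψ ᵥ* g₁ with hθ
  have hθ0 : θ ≠ 0 := fun h0 => hψ (by
    have : ψ ᵥ* g₁ = 0 ᵥ* g₁ := by rw [← hθ, h0, zero_vecMul]
    exact Matrix.vecMul_injective_of_isUnit ((isUnit_iff_isUnit_det _).2 hd₁.isUnit) this)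
  have hθv : θ ⬝ᵥ v = φ ⬝ᵥ v := by
    rw [hθ, ← dotProduct_mulVec, hg₁v, dotProduct_comm, ← h, dotProduct_comm]
  obtain ⟨u, hu1, hu2⟩ := exists_dotProduct_eq_one_and_ne_zero hθ0 hφ
  -- It fixes v because θ and φ agree on v, and carries θ to φ because θ·u = 1; its determinant is
  -- φ·u.
  set g₂ : Matrix (Fin n) (Fin n) F := 1 + vecMulVec u (φ - θ) with hg₂
  have hd₂ : g₂.det ≠ 0 := by
    rw [det_one_add_vecMulVec, sub_dotProduct, hu1]
    simpa using hu2
  have hg₂v : g₂ *ᵥ v = v := by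
    rw [hg₂, add_mulVec, one_mulVec, vecMulVec_mulVec, sub_dotProduct, hθv]
    simp
  refine ⟨GeneralLinearGroup.mkOfDetNeZero (g₁ * g₂) (by rw [det_mul]; exact mul_ne_zero hd₁ hd₂),
    ?_, ?_⟩
  · change (g₁ * g₂) *ᵥ v = w
    rw [← mulVec_mulVec, hg₂v, hg₁v]
  · change ψ ᵥ* (g₁ * g₂) = φ
    rw [← vecMul_vecMul, ← hθ, hg₂, vecMul_add, vecMul_one, vecMul_vecMulVec, hu1]
    simp

theorem vecMulVec_eq_vecMulVec_iff {v w φ ψ : Fin n → F} (hv : v ≠ 0) (hφ : φ ≠ 0) :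
    vecMulVec w ψ = vecMulVec v φ ↔ ∃ a : Fˣ, w = a • v ∧ ψ = a⁻¹ • φ := by
  refine ⟨fun h => ?_, ?_⟩
  · have h' : ∀ i j, w i * ψ j = v i * φ j := fun i j => congrFun (congrFun h i) j
    obtain ⟨i, hi⟩ := Function.ne_iff.1 hv
    obtain ⟨j, hj⟩ := Function.ne_iff.1 hφ
    simp only [Pi.zero_apply] at hi hj
    have hij : w i * ψ j ≠ 0 := by rw [h']; exact mul_ne_zero hi hj
    have hψj : ψ j ≠ 0 := right_ne_zero_of_mul hij
    have hw : ∀ k, w k = φ j / ψ j * v k := fun k => by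
      have := h' k j
      field_simp
      linear_combination this
    refine ⟨Units.mk0 (φ j / ψ j) (div_ne_zero hj hψj), funext hw, funext fun k => ?_⟩
    have h1 := h' i k
    rw [hw i] at h1
    simp only [Pi.smul_apply, Units.smul_def, Units.val_inv_eq_inv_val, Units.val_mk0, smul_eq_mul]
    field_simp at h1 ⊢
    linear_combination h1
  · rintro ⟨a, rfl, rfl⟩
    rw [smul_vecMulVec, vecMulVec_smul, smul_smul]
    simp

/-- The pairs `(v, φ)` for which `1 + v φᵀ` is a reflection (in characteristic different from `2`)
or a transvection (in characteristic `2`). -/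
def involutionPairs (F : Type*) [Field F] (n : ℕ) : Set ((Fin n → F) × (Fin n → F)) :=
  {p | p.1 ≠ 0 ∧ p.2 ≠ 0 ∧ p.1 ⬝ᵥ p.2 = -2}

/-- The matrix `ε (1 + v φᵀ)`. -/
def rankOneUpdate (ε : F) (p : (Fin n → F) × (Fin n → F)) : Matrix (Fin n) (Fin n) F :=
  ε • (1 + vecMulVec p.1 p.2)

theorem rankOneUpdate_eq_iff {ε : F} (hε : ε ≠ 0) {p p' : (Fin n → F) × (Fin n → F)} :
    rankOneUpdate ε p = rankOneUpdate ε p' ↔ vecMulVec p.1 p.2 = vecMulVec p'.1 p'.2 := by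
  rw [rankOneUpdate, rankOneUpdate, smul_right_inj hε, add_right_inj]

/-- Up to ε², the commutator is (w·φ)vψᵀ - (v·ψ)wφᵀ. If one coefficient vanishes, so does the other.
-/
theorem rankOneUpdate_mul_comm_iff {ε : F} (hε : ε ≠ 0) {p p' : (Fin n → F) × (Fin n → F)}
    (hp : p ∈ involutionPairs F n) (hp' : p' ∈ involutionPairs F n) :
    rankOneUpdate ε p * rankOneUpdate ε p' = rankOneUpdate ε p' * rankOneUpdate ε p ↔
      rankOneUpdate ε p' = rankOneUpdate ε p ∨ (p'.1 ⬝ᵥ p.2 = 0 ∧ p.1 ⬝ᵥ p'.2 = 0) := by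
  obtain ⟨v, φ⟩ := p
  obtain ⟨w, ψ⟩ := p'
  obtain ⟨hv, hφ, hvφ⟩ := hp
  obtain ⟨hw, hψ, hwψ⟩ := hp'
  dsimp only at hv hφ hvφ hw hψ hwψ ⊢
  have e1 : rankOneUpdate ε (v, φ) * rankOneUpdate ε (w, ψ) =
      rankOneUpdate ε (w, ψ) * rankOneUpdate ε (v, φ) ↔
      (w ⬝ᵥ φ) • vecMulVec v ψ = (v ⬝ᵥ ψ) • vecMulVec w φ := by
    simp only [rankOneUpdate, smul_mul_smul_comm]
    rw [smul_right_inj (mul_ne_zero hε hε)]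
    have e : (1 + vecMulVec v φ) * (1 + vecMulVec w ψ) - (1 + vecMulVec w ψ) * (1 + vecMulVec v φ) =
        (w ⬝ᵥ φ) • vecMulVec v ψ - (v ⬝ᵥ ψ) • vecMulVec w φ := by
      simp only [add_mul, mul_add, one_mul, mul_one, vecMulVec_mul_vecMulVec, vecMulVec_smul,
        dotProduct_comm φ w, dotProduct_comm ψ v]
      abel
    rw [← sub_eq_zero, e, sub_eq_zero]
  rw [e1, rankOneUpdate_eq_iff hε]
  dsimp only
  constructor
  · intro h
    by_cases h1 : w ⬝ᵥ φ = 0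
    · rw [h1, zero_smul] at h
      exact .inr ⟨h1, (smul_eq_zero.1 h.symm).resolve_right (vecMulVec_ne_zero hw hφ)⟩
    · have h2 : v ⬝ᵥ ψ ≠ 0 := fun h2 => by
        rw [h2, zero_smul] at h
        exact (smul_eq_zero.1 h).elim h1 (vecMulVec_ne_zero hv hψ)
      left
      -- Evaluating the identity at w, and below at φ from the left, shows (v·ψ)wψᵀ = -2vψᵀ =
      -- (v·ψ)vφᵀ. Nothing is divided by 2, so the argument covers every characteristic.
      have h3 : (-2 : F) • v = (v ⬝ᵥ ψ) • w := by
        have := congrArg (fun M => M *ᵥ w) h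
        simp only [smul_mulVec, vecMulVec_mulVec, dotProduct_comm ψ w, hwψ, dotProduct_comm φ w,
          op_smul_eq_smul] at this
        rw [smul_comm (v ⬝ᵥ ψ)] at this
        exact smul_right_injective _ h1 this
      have h4 : (-2 : F) • ψ = (v ⬝ᵥ ψ) • φ := by
        have := congrArg (fun M => φ ᵥ* M) h
        simp only [vecMul_smul, vecMul_vecMulVec, dotProduct_comm φ v, hvφ,
          dotProduct_comm φ w] at this
        rw [smul_comm (v ⬝ᵥ ψ)] at this
        exact smul_right_injective _ h1 this
      refine smul_right_injective _ h2 ?_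
      dsimp only
      rw [← smul_vecMulVec, ← h3, smul_vecMulVec, ← vecMulVec_smul, h4, vecMulVec_smul]
  · rintro (h | ⟨h1, h2⟩)
    · obtain ⟨a, rfl, rfl⟩ := (vecMulVec_eq_vecMulVec_iff hv hφ).1 h
      simp [smul_vecMulVec, vecMulVec_smul, hvφ, Units.smul_def, smul_smul, mul_comm]
    · rw [h1, h2, zero_smul, zero_smul]

end RankOne

/-! ### The classes as sets of rank-one updates; common orthogonal pairs -/

section Classes

open Matrix

variable {F : Type*} [Field F] {n : ℕ}

theorem coe_mul_mul_inv_eq_rankOneUpdate {s g : GL (Fin n) F} {ε : F}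
    {p : (Fin n → F) × (Fin n → F)}
    (hs : (s : Matrix (Fin n) (Fin n) F) = rankOneUpdate ε p) :
    ((g * s * g⁻¹ : GL (Fin n) F) : Matrix (Fin n) (Fin n) F) =
      rankOneUpdate ε ((g : Matrix (Fin n) (Fin n) F) *ᵥ p.1,
        p.2 ᵥ* ((g⁻¹ : GL (Fin n) F) : Matrix (Fin n) (Fin n) F)) := by
  have h : (g : Matrix (Fin n) (Fin n) F) * ((g⁻¹ : GL (Fin n) F) : Matrix (Fin n) (Fin n) F) = 1 :=
    Units.mul_inv g
  rw [Units.val_mul, Units.val_mul, hs, rankOneUpdate, rankOneUpdate, mul_smul_comm,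
    smul_mul_assoc, mul_add, add_mul, mul_one, h, mul_vecMulVec, vecMulVec_mul]

/-- A conjugacy class of `GL n F` containing one matrix `ε (1 + v φᵀ)` with `(v, φ)` an involution
pair consists of all matrices of this form. -/
theorem coe_image_conjClass {s : GL (Fin n) F} {ε : F} {p : (Fin n → F) × (Fin n → F)}
    (hp : p ∈ involutionPairs F n) (hs : (s : Matrix (Fin n) (Fin n) F) = rankOneUpdate ε p) :
    (fun x : GL (Fin n) F => (x : Matrix (Fin n) (Fin n) F)) '' {x | IsConj s x} =
      rankOneUpdate ε '' involutionPairs F n := by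
  obtain ⟨hv, hφ, hvφ⟩ := hp
  ext M
  constructor
  · rintro ⟨x, hx, rfl⟩
    obtain ⟨g, rfl⟩ := isConj_iff.1 hx
    refine ⟨_, ⟨?_, ?_, ?_⟩, (coe_mul_mul_inv_eq_rankOneUpdate hs).symm⟩
    · intro h
      exact hv (mulVec_injective_of_isUnit g.isUnit (by simpa using h))
    · intro h
      exact hφ (vecMul_injective_of_isUnit (g⁻¹).isUnit (h.trans (zero_vecMul _).symm))
    · dsimp only
      rw [dotProduct_comm, ← dotProduct_mulVec, mulVec_mulVec, Units.inv_mul, one_mulVec,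
        dotProduct_comm, hvφ]
  · rintro ⟨p', ⟨hw, hψ, hwψ⟩, rfl⟩
    obtain ⟨g, hg1, hg2⟩ := exists_mulVec_eq_and_vecMul_eq hv hw hφ hψ (hvφ.trans hwψ.symm)
    refine ⟨g * s * g⁻¹, isConj_iff.2 ⟨g, rfl⟩, (coe_mul_mul_inv_eq_rankOneUpdate hs).trans ?_⟩
    rw [hg1, ← hg2, vecMul_vecMul, Units.mul_inv, vecMul_one]

/-- The sign ε serves k = 3, where diag(1, -1, -1, -1) is minus the reflection diag(-1, 1, 1, 1). -/
theorem exists_standardInvolution_eq_rankOneUpdate {k : ℕ}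
    (hk : k = 1 ∨ (ringChar F ≠ 2 ∧ k = 3)) :
    ∃ ε : F, ε ≠ 0 ∧ ∃ p ∈ involutionPairs F 4,
      (standardInvolution F 4 k : Matrix (Fin 4) (Fin 4) F) = rankOneUpdate ε p := by
  have hcoe : (standardInvolution F 4 k : Matrix (Fin 4) (Fin 4) F) = involutionMatrix F 4 k := rfl
  rw [hcoe, involutionMatrix]
  by_cases h : ringChar F = 2
  · obtain rfl : k = 1 := hk.resolve_right fun h' => h'.1 h
    refine ⟨1, one_ne_zero, (Pi.single 3 1, Pi.single 2 1), ⟨by simp, by simp, ?_⟩, ?_⟩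
    · simp [two_eq_zero_iff_ringChar.2 h]
    · rw [if_pos h]
      ext i j
      fin_cases i <;> fin_cases j <;> simp [rankOneUpdate, vecMulVec_apply]
  · have h2 : (2 : F) ≠ 0 := fun h' => h (two_eq_zero_iff_ringChar.1 h')
    rw [if_neg h]
    rcases hk with rfl | ⟨-, rfl⟩
    · refine ⟨1, one_ne_zero, (Pi.single 3 1, Pi.single 3 (-2)), ⟨by simp, by simpa, by simp⟩, ?_⟩
      ext i j
      fin_cases i <;> fin_cases j <;> simp [rankOneUpdate, vecMulVec_apply]; norm_num
    · refine ⟨-1, by simp, (Pi.single 0 1, Pi.single 0 (-2)), ⟨by simp, by simpa, by simp⟩, ?_⟩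
      ext i j
      fin_cases i <;> fin_cases j <;> simp [rankOneUpdate, vecMulVec_apply]; norm_num

theorem exists_ne_zero_forall_dotProduct_eq_zero {m : ℕ} (hm : m < n) (v : Fin m → Fin n → F) :
    ∃ x : Fin n → F, x ≠ 0 ∧ ∀ i, v i ⬝ᵥ x = 0 := by
  have h := LinearMap.ker_ne_bot_of_finrank_lt (f := (Matrix.of v).mulVecLin) (by simpa using hm)
  obtain ⟨x, hx, hx0⟩ := Submodule.exists_mem_ne_zero_of_ne_bot h
  exact ⟨x, hx0, fun i => congrFun (LinearMap.mem_ker.1 hx) i⟩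

theorem exists_dotProduct_eq_of_notMem {S : Submodule F (Fin n → F)} {z : Fin n → F}
    (hz : z ∉ S) (c : F) : ∃ χ : Fin n → F, (∀ y ∈ S, y ⬝ᵥ χ = 0) ∧ z ⬝ᵥ χ = c := by
  obtain ⟨f, hfz, hf⟩ := Submodule.exists_le_ker_of_notMem hz
  have hdot : ∀ y : Fin n → F, y ⬝ᵥ (fun i => f (Pi.single i 1)) = f y := fun y => by
    conv_rhs => rw [pi_eq_sum_univ' y]
    simp [dotProduct, map_sum]
  refine ⟨(c / f z) • fun i => f (Pi.single i 1), fun y hy => ?_, ?_⟩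
  · rw [dotProduct_smul, hdot, LinearMap.mem_ker.1 (hf hy), smul_zero]
  · rw [dotProduct_smul, hdot, smul_eq_mul, div_mul_cancel₀ _ hfz]

/-- Any two involution pairs in dimension `4` are jointly orthogonal to a third one. -/
theorem exists_orthogonal_involutionPair {p p' : (Fin 4 → F) × (Fin 4 → F)}
    (hp : p ∈ involutionPairs F 4) :
    ∃ r ∈ involutionPairs F 4, r.1 ⬝ᵥ p.2 = 0 ∧ p.1 ⬝ᵥ r.2 = 0 ∧ r.1 ⬝ᵥ p'.2 = 0 ∧
      p'.1 ⬝ᵥ r.2 = 0 := by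
  obtain ⟨v, φ⟩ := p
  obtain ⟨w, ψ⟩ := p'
  obtain ⟨hv, hφ, hvφ⟩ := hp
  dsimp only at *
  by_cases h2 : (2 : F) = 0
  -- Here -2 = 0, so z·χ = 0 is just a third linear condition on χ, and three conditions in
  -- dimension 4 leave a nonzero solution.
  · obtain ⟨z, hz0, hz⟩ := exists_ne_zero_forall_dotProduct_eq_zero (by norm_num) ![φ, ψ]
    obtain ⟨χ, hχ0, hχ⟩ := exists_ne_zero_forall_dotProduct_eq_zero (by norm_num) ![v, w, z]
    refine ⟨(z, χ), ⟨hz0, hχ0, ?_⟩, ?_, hχ 0, ?_, hχ 1⟩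
    · exact (hχ 2).trans (by simp [h2])
    · rw [dotProduct_comm]; exact hz 0
    · rw [dotProduct_comm]; exact hz 1
  · set K := LinearMap.ker (Matrix.of ![φ, ψ]).mulVecLin
    have hK : ∀ z ∈ K, z ⬝ᵥ φ = 0 ∧ z ⬝ᵥ ψ = 0 := fun z hz => by
      have h := LinearMap.mem_ker.1 hz
      exact ⟨(dotProduct_comm _ _).trans (congrFun h 0), (dotProduct_comm _ _).trans (congrFun h 1)⟩
    -- dim K ≥ 2 ≥ dim span{v, w}, so inclusion would be equality and put v in K, against v·φ = -2 ≠
    -- 0. A vector of K off the span then admits a covector killing v and w with value -2 on it.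
    have hKS : ¬ K ≤ Submodule.span F {v, w} := fun hle => by
      have hK2 : 2 ≤ Module.finrank F K := by
        have h1 := LinearMap.finrank_range_add_finrank_ker (Matrix.of ![φ, ψ]).mulVecLin
        have h3 := (LinearMap.range (Matrix.of ![φ, ψ]).mulVecLin).finrank_le
        simp only [Module.finrank_fin_fun] at h1 h3
        change 2 ≤ Module.finrank F (LinearMap.ker (Matrix.of ![φ, ψ]).mulVecLin)
        omega
      have hS2 : Module.finrank F (Submodule.span F {v, w}) ≤ 2 := by
        classical
        have := finrank_span_finset_le_card (R := F) ({v, w} : Finset (Fin 4 → F))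
        rw [Finset.coe_pair] at this
        exact this.trans Finset.card_le_two
      have hmem : v ∈ K := by
        rw [Submodule.eq_of_le_of_finrank_le hle (hS2.trans hK2)]
        exact Submodule.subset_span (by simp)
      rw [(hK v hmem).1] at hvφ
      exact h2 (by simpa using hvφ.symm)
    obtain ⟨z, hzK, hzS⟩ := SetLike.not_le_iff_exists.1 hKS
    obtain ⟨χ, hχ, hzχ⟩ := exists_dotProduct_eq_of_notMem hzS (-2)
    have hne : z ⬝ᵥ χ ≠ 0 := by simpa [hzχ] using h2
    refine ⟨(z, χ), ⟨?_, ?_, hzχ⟩, (hK z hzK).1, hχ v (Submodule.subset_span (by simp)),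
      (hK z hzK).2, hχ w (Submodule.subset_span (by simp))⟩
    · rintro rfl; simp at hne
    · rintro rfl; simp at hne

end Classes

/-! ### Counting over fibres and solutions of linear systems -/

section Counting

open Matrix

theorem Set.ncard_setOf_mem_and_mem {α β : Type*} [Finite α] [Finite β] {A : Set α}
    {B : α → Set β} {m : ℕ} (h : ∀ a ∈ A, (B a).ncard = m) :
    {p : α × β | p.1 ∈ A ∧ p.2 ∈ B p.1}.ncard = A.ncard * m := by
  classical
  have := Fintype.ofFinite A
  have e : {p : α × β | p.1 ∈ A ∧ p.2 ∈ B p.1} ≃ Σ a : A, B a :=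
    { toFun := fun p => ⟨⟨p.1.1, p.2.1⟩, ⟨p.1.2, p.2.2⟩⟩
      invFun := fun p => ⟨(p.1.1, p.2.1), p.1.2, p.2.2⟩
      left_inv := fun _ => rfl
      right_inv := fun _ => rfl }
  rw [← Nat.card_coe_set_eq, Nat.card_congr e, Nat.card_sigma,
    Finset.sum_congr rfl fun (a : A) _ => (Nat.card_coe_set_eq _).trans (h a a.2)]
  rw [Finset.sum_const, Finset.card_univ, smul_eq_mul, ← Nat.card_eq_fintype_card,
    Nat.card_coe_set_eq]

variable {F : Type*} [Field F] [Finite F] {n : ℕ}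

theorem ncard_setOf_dotProduct_eq {m : ℕ} {v : Fin m → Fin n → F} (hv : LinearIndependent F v)
    (c : Fin m → F) :
    {x : Fin n → F | ∀ i, v i ⬝ᵥ x = c i}.ncard = Nat.card F ^ (n - m) := by
  set A := (Matrix.of v).mulVecLin with hA
  have hrank : Module.finrank F (LinearMap.range A) = m := by
    have h : (Matrix.of v).rank = Fintype.card (Fin m) := LinearIndependent.rank_matrix hv
    exact h.trans (Fintype.card_fin m)
  have hsurj : LinearMap.range A = ⊤ := Submodule.eq_top_of_finrank_eq (by simpa using hrank)
  obtain ⟨x₀, hx₀⟩ := LinearMap.range_eq_top.1 hsurj c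
  have himg : {x : Fin n → F | ∀ i, v i ⬝ᵥ x = c i} = (x₀ + ·) '' (LinearMap.ker A : Set _) := by
    ext x
    have hx : x ∈ {x : Fin n → F | ∀ i, v i ⬝ᵥ x = c i} ↔ A x = c := funext_iff.symm
    rw [hx]
    constructor
    · intro h
      exact ⟨x - x₀, by simp [h, hx₀], by simp⟩
    · rintro ⟨y, hy, rfl⟩
      rw [map_add, hx₀, LinearMap.mem_ker.1 hy, add_zero]
  have hker : Module.finrank F (LinearMap.ker A) = n - m := by
    have := LinearMap.finrank_range_add_finrank_ker A
    rw [hrank, Module.finrank_fin_fun] at this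
    omega
  rw [himg, Set.ncard_image_of_injective _ (add_right_injective x₀), ← Nat.card_coe_set_eq]
  exact (Module.natCard_eq_pow_finrank (K := F)).trans (by rw [← hker]; rfl)

theorem ncard_setOf_dotProduct_eq_one {v : Fin n → F} (hv : v ≠ 0) (c : F) :
    {x : Fin n → F | v ⬝ᵥ x = c}.ncard = Nat.card F ^ (n - 1) := by
  have h := ncard_setOf_dotProduct_eq (v := ![v])
    (LinearIndependent.of_subsingleton (0 : Fin 1) hv) ![c]
  simpa using h

theorem ncard_setOf_dotProduct_eq_two {v w : Fin n → F} (hvw : LinearIndependent F ![v, w])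
    (c d : F) :
    {x : Fin n → F | v ⬝ᵥ x = c ∧ w ⬝ᵥ x = d}.ncard = Nat.card F ^ (n - 2) := by
  have h := ncard_setOf_dotProduct_eq hvw ![c, d]
  simpa [Fin.forall_fin_two] using h

end Counting

/-! ### Numbers of involution pairs and of orthogonal pairs -/

section InvolutionPairCounts

open Matrix

variable {F : Type*} [Field F]

theorem ncard_setOf_ne_zero {n : ℕ} :
    {w : Fin n → F | w ≠ 0}.ncard = Nat.card F ^ n - 1 := by
  have h : {w : Fin n → F | w ≠ 0} = Set.univ \ {0} := by ext; simp
  rw [h, Set.ncard_sdiff_singleton_of_mem (Set.mem_univ _), Set.ncard_univ, Nat.card_fun]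
  simp

/-- Each matrix `ε (1 + v φᵀ)` comes from `q - 1` pairs. -/
theorem ncard_involutionPairs_inter_preimage {n : ℕ} {ε : F} (hε : ε ≠ 0)
    {S : Set (Matrix (Fin n) (Fin n) F)} (hS : S ⊆ rankOneUpdate ε '' involutionPairs F n) :
    (involutionPairs F n ∩ rankOneUpdate ε ⁻¹' S).ncard = S.ncard * (Nat.card F - 1) := by
  have hS' : ∀ M : Matrix (Fin n) (Fin n) F, M ∈ S →
      ∃ p ∈ involutionPairs F n, rankOneUpdate ε p = M := fun M hM => hS hM
  choose! r hr hrM using hS'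
  -- With one pair r(M) chosen for each M, the units act simply transitively on the pairs giving M.
  set f : Matrix (Fin n) (Fin n) F × Fˣ → (Fin n → F) × (Fin n → F) :=
    fun x => (x.2 • (r x.1).1, x.2⁻¹ • (r x.1).2) with hf
  have hfM : ∀ x : Matrix (Fin n) (Fin n) F × Fˣ, x.1 ∈ S → rankOneUpdate ε (f x) = x.1 := by
    intro x hx
    obtain ⟨h1, h2, -⟩ := hr _ hx
    conv_rhs => rw [← hrM _ hx]
    rw [rankOneUpdate_eq_iff hε, vecMulVec_eq_vecMulVec_iff h1 h2]
    exact ⟨x.2, rfl, rfl⟩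
  have himg : involutionPairs F n ∩ rankOneUpdate ε ⁻¹' S = f '' (S ×ˢ Set.univ) := by
    ext p
    constructor
    · rintro ⟨hp, hpS⟩
      obtain ⟨h1, h2, -⟩ := hr _ hpS
      have hM := hrM _ hpS
      rw [rankOneUpdate_eq_iff hε, eq_comm, vecMulVec_eq_vecMulVec_iff h1 h2] at hM
      obtain ⟨a, ha1, ha2⟩ := hM
      exact ⟨(rankOneUpdate ε p, a), ⟨hpS, trivial⟩, Prod.ext ha1.symm ha2.symm⟩
    · rintro ⟨x, ⟨hx, -⟩, rfl⟩
      obtain ⟨h1, h2, h3⟩ := hr _ hx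
      refine ⟨⟨?_, ?_, ?_⟩, ?_⟩
      · exact (smul_ne_zero_iff_ne x.2).2 h1
      · exact (smul_ne_zero_iff_ne x.2⁻¹).2 h2
      · simp [hf, h3]
      · rw [Set.mem_preimage, hfM x hx]
        exact hx
  have hinj : Set.InjOn f (S ×ˢ Set.univ) := by
    rintro ⟨M, a⟩ ⟨hM, -⟩ ⟨M', b⟩ ⟨hM', -⟩ h
    obtain rfl : M = M' := by
      have := congrArg (rankOneUpdate ε) h
      rwa [hfM _ hM, hfM _ hM'] at this
    have h1 : (a : F) • (r M).1 = (b : F) • (r M).1 := (Prod.ext_iff.1 h).1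
    rw [Units.ext (smul_left_injective F (hr M hM).1 h1)]
  rw [himg, hinj.ncard_image, Set.ncard_prod, Set.ncard_univ, Nat.card_units]

variable [Finite F]

theorem ncard_involutionPairs_of_two_eq_zero (h2 : (2 : F) = 0) :
    (involutionPairs F 4).ncard = (Nat.card F ^ 4 - 1) * (Nat.card F ^ 3 - 1) := by
  rw [← ncard_setOf_ne_zero, ← Set.ncard_setOf_mem_and_mem
    (B := fun w : Fin 4 → F => {ψ | w ⬝ᵥ ψ = 0} \ {0})]
  · congr 1
    ext p
    simp only [involutionPairs, h2, neg_zero, Set.mem_ofPred_eq, Set.mem_sdiff,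
      Set.mem_singleton_iff]
    tauto
  · intro w hw
    rw [Set.ncard_sdiff_singleton_of_mem (by simp), ncard_setOf_dotProduct_eq_one hw]

theorem ncard_involutionPairs_of_two_ne_zero (h2 : (2 : F) ≠ 0) :
    (involutionPairs F 4).ncard = (Nat.card F ^ 4 - 1) * Nat.card F ^ 3 := by
  rw [← ncard_setOf_ne_zero, ← Set.ncard_setOf_mem_and_mem
    (B := fun w : Fin 4 → F => {ψ | w ⬝ᵥ ψ = -2})]
  · congr 1
    ext p
    simp only [involutionPairs, Set.mem_ofPred_eq]
    refine ⟨fun h => ⟨h.1, h.2.2⟩, fun h => ⟨h.1, fun h0 => h2 ?_, h.2⟩⟩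
    rw [h0, dotProduct_zero] at h
    simpa using h.2.symm
  · intro w hw
    exact ncard_setOf_dotProduct_eq_one hw _

/-- The involution pairs `(w, ψ)` with `w ⬝ᵥ φ = 0` and `v ⬝ᵥ ψ = 0`, for a given pair `(v, φ)`. -/
def orthogonalPairs {n : ℕ} (p : (Fin n → F) × (Fin n → F)) : Set ((Fin n → F) × (Fin n → F)) :=
  {p' ∈ involutionPairs F n | p'.1 ⬝ᵥ p.2 = 0 ∧ p.1 ⬝ᵥ p'.2 = 0}

/-- Nonzero w in the hyperplane φ·w = 0 is independent of v, as v·φ ≠ 0. Hence v·ψ = 0 and w·ψ = -2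
are independent conditions, the second of which forces ψ ≠ 0. -/
theorem ncard_orthogonalPairs_of_two_ne_zero (h2 : (2 : F) ≠ 0)
    {p : (Fin 4 → F) × (Fin 4 → F)} (hp : p ∈ involutionPairs F 4) :
    (orthogonalPairs p).ncard = (Nat.card F ^ 3 - 1) * Nat.card F ^ 2 := by
  obtain ⟨v, φ⟩ := p
  obtain ⟨hv, hφ, hvφ⟩ := hp
  dsimp only at hv hφ hvφ
  have hA : ({w | φ ⬝ᵥ w = 0} \ {0} : Set (Fin 4 → F)).ncard = Nat.card F ^ 3 - 1 := by
    rw [Set.ncard_sdiff_singleton_of_mem (by simp), ncard_setOf_dotProduct_eq_one hφ]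
  rw [← hA, ← Set.ncard_setOf_mem_and_mem
    (B := fun w : Fin 4 → F => {ψ | v ⬝ᵥ ψ = 0 ∧ w ⬝ᵥ ψ = -2})]
  · congr 1
    ext p
    simp only [orthogonalPairs, involutionPairs, Set.mem_ofPred_eq, Set.mem_sdiff,
      Set.mem_singleton_iff, dotProduct_comm φ]
    refine ⟨fun h => ⟨⟨h.2.1, h.1.1⟩, h.2.2, h.1.2.2⟩,
      fun h => ⟨⟨h.1.2, fun h0 => h2 ?_, h.2.2⟩, h.1.1, h.2.1⟩⟩
    have := h.2.2
    rw [h0, dotProduct_zero] at this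
    simpa using this.symm
  · rintro w ⟨hw, hw0⟩
    refine ncard_setOf_dotProduct_eq_two ((LinearIndependent.pair_iff' hv).2 fun a ha => ?_) _ _
    have h : φ ⬝ᵥ w = 0 := hw
    rw [← ha, dotProduct_smul, dotProduct_comm, hvφ, smul_eq_mul, mul_eq_zero, neg_eq_zero] at h
    obtain rfl := h.resolve_right h2
    exact hw0 (by simp [← ha])

/-- Now v lies in the hyperplane φ·w = 0. For w on the line through v the conditions v·ψ = 0 and w·ψ
= 0 coincide; off that line they are independent. The two summands count these cases. -/
theorem ncard_orthogonalPairs_of_two_eq_zero (h2 : (2 : F) = 0)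
    {p : (Fin 4 → F) × (Fin 4 → F)} (hp : p ∈ involutionPairs F 4) :
    (orthogonalPairs p).ncard = (Nat.card F - 1) * (Nat.card F ^ 3 - 1) +
      (Nat.card F ^ 3 - Nat.card F) * (Nat.card F ^ 2 - 1) := by
  obtain ⟨v, φ⟩ := p
  obtain ⟨hv, hφ, hvφ⟩ := hp
  dsimp only at hv hφ hvφ
  rw [h2, neg_zero] at hvφ
  set L : Set (Fin 4 → F) := Set.range fun a : F => a • v with hL
  have hLcard : L.ncard = Nat.card F := by
    rw [hL, ← Set.image_univ, Set.ncard_image_of_injective _ (smul_left_injective F hv),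
      Set.ncard_univ]
  have hLφ : L ⊆ {w | φ ⬝ᵥ w = 0} := by
    rintro _ ⟨a, rfl⟩
    simp [dotProduct_comm φ, hvφ]
  have h0L : (0 : Fin 4 → F) ∈ L := ⟨0, by simp⟩
  have hA₁ : (L \ {0}).ncard = Nat.card F - 1 := by
    rw [Set.ncard_sdiff_singleton_of_mem h0L, hLcard]
  have hA₂ : ({w | φ ⬝ᵥ w = 0} \ L).ncard = Nat.card F ^ 3 - Nat.card F := by
    rw [Set.ncard_sdiff hLφ, hLcard, ncard_setOf_dotProduct_eq_one hφ]
  rw [← hA₁, ← hA₂, ← Set.ncard_setOf_mem_and_mem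
      (B := fun _ : Fin 4 → F => {ψ | v ⬝ᵥ ψ = 0} \ {0}),
    ← Set.ncard_setOf_mem_and_mem
      (B := fun w : Fin 4 → F => {ψ | v ⬝ᵥ ψ = 0 ∧ w ⬝ᵥ ψ = 0} \ {0}),
    ← Set.ncard_union_eq]
  · congr 1
    ext ⟨w, ψ⟩
    have hLψ : w ∈ L → v ⬝ᵥ ψ = 0 → w ⬝ᵥ ψ = 0 := by
      rintro ⟨a, rfl⟩ h
      simp [h]
    have hLφ' : w ∈ L → φ ⬝ᵥ w = 0 := fun h => hLφ h
    have hw0 : w = 0 → w ∈ L := fun h => h ▸ h0L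
    simp only [orthogonalPairs, involutionPairs, Set.mem_ofPred_eq, Set.mem_sdiff,
      Set.mem_singleton_iff, dotProduct_comm w φ, h2, neg_zero, Set.mem_union]
    tauto
  · rw [Set.disjoint_left]
    rintro x ⟨⟨h, -⟩, -⟩ ⟨⟨-, h'⟩, -⟩
    exact h' h
  · rintro w ⟨-, hw⟩
    rw [Set.ncard_sdiff_singleton_of_mem (by simp), ncard_setOf_dotProduct_eq_two
      ((LinearIndependent.pair_iff' hv).2 fun a ha => hw ⟨a, ha⟩)]
  · intro w _
    rw [Set.ncard_sdiff_singleton_of_mem (by simp), ncard_setOf_dotProduct_eq_one hv]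

end InvolutionPairCounts

/-! ### Transfer from pairs to the class, and the final count -/

open Matrix in
theorem exists_commute_of_mem_involutionClass {F : Type*} [Field F] {k : ℕ}
    (hk : k = 1 ∨ (ringChar F ≠ 2 ∧ k = 3)) :
    ∀ x ∈ involutionClass F 4 k, ∀ y ∈ involutionClass F 4 k, ¬ Commute x y →
      ∃ z ∈ involutionClass F 4 k, Commute x z ∧ Commute z y := by
  obtain ⟨ε, hε, p₀, hp₀, hs⟩ := exists_standardInvolution_eq_rankOneUpdate hk
  have himg := coe_image_conjClass hp₀ hs
  intro x hx y hy _
  obtain ⟨p, hp, hpx⟩ := himg.subset ⟨x, hx, rfl⟩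
  obtain ⟨p', hp', hpy⟩ := himg.subset ⟨y, hy, rfl⟩
  obtain ⟨r, hr, h1, h2, h3, h4⟩ := exists_orthogonal_involutionPair (p' := p') hp
  obtain ⟨z, hz, hrz⟩ := himg.symm.subset ⟨r, hr, rfl⟩
  dsimp only at hpx hpy hrz
  refine ⟨z, hz, Units.ext ?_, Units.ext ?_⟩
  · rw [Units.val_mul, Units.val_mul, hrz, ← hpx, rankOneUpdate_mul_comm_iff hε hp hr]
    exact .inr ⟨h1, h2⟩
  · rw [Units.val_mul, Units.val_mul, hrz, ← hpy, rankOneUpdate_mul_comm_iff hε hr hp']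
    exact .inr ⟨h4, h3⟩

theorem ncard_involutionClass_mul {F : Type*} [Field F] [Finite F] {k : ℕ}
    (hk : k = 1 ∨ (ringChar F ≠ 2 ∧ k = 3)) :
    (involutionClass F 4 k).ncard * (Nat.card F - 1) = (involutionPairs F 4).ncard := by
  obtain ⟨ε, hε, p₀, hp₀, hs⟩ := exists_standardInvolution_eq_rankOneUpdate hk
  have himg := coe_image_conjClass hp₀ hs
  rw [involutionClass, ← Set.ncard_image_of_injective {x | IsConj (standardInvolution F 4 k) x}
    (Units.val_injective (α := Matrix (Fin 4) (Fin 4) F)), himg,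
    ← ncard_involutionPairs_inter_preimage hε subset_rfl]
  congr 1
  exact Set.inter_eq_left.2 (Set.subset_preimage_image _ _)

/-- The number of neighbours of `t`; in characteristic `2`, the vertex `t` itself is orthogonal
to `t` and is counted by `orthogonalPairs` as well. -/
theorem exists_ncard_distanceSphere_one {F : Type*} [Field F] [Finite F] {k : ℕ}
    (hk : k = 1 ∨ (ringChar F ≠ 2 ∧ k = 3)) (t : involutionClass F 4 k) :
    ∃ p ∈ involutionPairs F 4,
      ((distanceSphere t 1).ncard + if ringChar F = 2 then 1 else 0) * (Nat.card F - 1) =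
        (orthogonalPairs p).ncard := by
  classical
  obtain ⟨ε, hε, p₀, hp₀, hs⟩ := exists_standardInvolution_eq_rankOneUpdate hk
  have himg := coe_image_conjClass hp₀ hs
  obtain ⟨p, hp, hpt⟩ := himg.subset ⟨t, t.2, rfl⟩
  dsimp only at hpt
  refine ⟨p, hp, ?_⟩
  set N := {x : involutionClass F 4 k | Commute (t : GL (Fin 4) F) x} with hN
  let c : involutionClass F 4 k → Matrix (Fin 4) (Fin 4) F := fun x => (x : GL (Fin 4) F)
  have hc : Function.Injective c :=
    (Units.val_injective (α := Matrix (Fin 4) (Fin 4) F)).comp Subtype.val_injective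
  have hcS : ∀ T : Set (involutionClass F 4 k),
      c '' T ⊆ rankOneUpdate ε '' involutionPairs F 4 := by
    rintro T _ ⟨x, -, rfl⟩
    exact himg.subset ⟨x, x.2, rfl⟩
  have hcomm : ∀ (x : involutionClass F 4 k) (p' : (Fin 4 → F) × (Fin 4 → F)),
      p' ∈ involutionPairs F 4 → rankOneUpdate ε p' = c x →
      (x ∈ N ↔ x = t ∨ p' ∈ orthogonalPairs p) := by
    intro x p' hp' hx
    have h1 : x ∈ N ↔ c t * c x = c x * c t := ⟨fun h => congrArg Units.val h, fun h => Units.ext h⟩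
    rw [h1, ← hx, show c t = rankOneUpdate ε p from hpt.symm, rankOneUpdate_mul_comm_iff hε hp hp',
      hx, hpt, show ((t : GL (Fin 4) F) : Matrix (Fin 4) (Fin 4) F) = c t from rfl, hc.eq_iff]
    exact or_congr_right ⟨fun h => ⟨hp', h⟩, fun h => h.2⟩
  -- Every pair giving t is (av, a⁻¹φ), whose pairings with (v, φ) are unit multiples of -2.
  have hself : ∀ p' ∈ involutionPairs F 4, rankOneUpdate ε p' = c t →
      (p' ∈ orthogonalPairs p ↔ (2 : F) = 0) := by
    intro p' hp' hx
    rw [show c t = rankOneUpdate ε p from hpt.symm, rankOneUpdate_eq_iff hε,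
      vecMulVec_eq_vecMulVec_iff hp.1 hp.2.1] at hx
    obtain ⟨a, h1, h2⟩ := hx
    have h3 : (a : F) ≠ 0 := a.ne_zero
    simp [orthogonalPairs, hp', h1, h2, Units.smul_def, hp.2.2]
  have htN : t ∈ N := Commute.refl _
  -- T is N in characteristic 2 and N without t otherwise: exactly the matrices arising from
  -- orthogonal pairs.
  have key : ∀ T : Set (involutionClass F 4 k), (∀ x, x ∈ T ↔ x ∈ N ∧ (x = t → (2 : F) = 0)) →
      T.ncard * (Nat.card F - 1) = (orthogonalPairs p).ncard := by
    intro T hT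
    rw [← Set.ncard_image_of_injective T hc, ← ncard_involutionPairs_inter_preimage hε (hcS T)]
    congr 1
    ext p'
    constructor
    · rintro ⟨hp', x, hx, hxp⟩
      obtain ⟨hxN, hxt⟩ := (hT x).1 hx
      by_cases h : x = t
      · subst h
        exact (hself p' hp' hxp.symm).2 (hxt rfl)
      · exact ((hcomm x p' hp' hxp.symm).1 hxN).resolve_left h
    · intro h
      obtain ⟨x, hx, hxp⟩ := himg.symm.subset ⟨p', h.1, rfl⟩
      refine ⟨h.1, ⟨x, hx⟩, (hT _).2 ⟨(hcomm ⟨x, hx⟩ p' h.1 hxp.symm).2 (.inr h), ?_⟩, hxp⟩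
      intro ht
      exact (hself p' h.1 (by rw [← ht]; exact hxp.symm)).1 h
  rw [distanceSphere_one, ← hN]
  split_ifs with hch
  · rw [Set.ncard_sdiff_singleton_add_one htN]
    exact key N fun x => by simp [two_eq_zero_iff_ringChar.2 hch]
  · rw [add_zero]
    exact key _ fun x => by simp [mt two_eq_zero_iff_ringChar.1 hch]

theorem proposition3p1 {F : Type*} [Field F] [Finite F] (q : ℕ) (hq : Nat.card F = q)
    (k : ℕ) (hk : k = 1 ∨ (ringChar F ≠ 2 ∧ k = 3)) :
    (commutingGraph (involutionClass F 4 k)).Connected ∧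
    (commutingGraph (involutionClass F 4 k)).ediam = 2 ∧
    ∀ t : involutionClass F 4 k,
      ((distanceSphere t 1).ncard : ℤ) =
        (if ringChar F = 2 then (q : ℤ) ^ 4 + 2 * q ^ 3 - q ^ 2 - q - 2
          else (q : ℤ) ^ 4 + q ^ 3 + q ^ 2) ∧
      ((distanceSphere t 2).ncard : ℤ) =
        (if ringChar F = 2 then (q : ℤ) ^ 6 + q ^ 5 - 2 * q ^ 3
          else (q : ℤ) ^ 6 + q ^ 5 - q ^ 2 - 1) := by
  have hX := exists_commute_of_mem_involutionClass hk
  have hq1 : 1 < q := hq ▸ Finite.one_lt_card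
  have hqz : (1 : ℤ) < q := by exact_mod_cast hq1
  have hq0 : (q : ℤ) - 1 ≠ 0 := by linarith
  have hpow : ∀ m, 1 ≤ q ^ m := fun m => Nat.one_le_pow _ _ (by omega)
  have hcount : ∀ t : involutionClass F 4 k,
      ((distanceSphere t 1).ncard : ℤ) =
        (if ringChar F = 2 then (q : ℤ) ^ 4 + 2 * q ^ 3 - q ^ 2 - q - 2
          else (q : ℤ) ^ 4 + q ^ 3 + q ^ 2) ∧
      ((distanceSphere t 2).ncard : ℤ) =
        (if ringChar F = 2 then (q : ℤ) ^ 6 + q ^ 5 - 2 * q ^ 3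
          else (q : ℤ) ^ 6 + q ^ 5 - q ^ 2 - 1) := by
    intro t
    have htotal := ncard_involutionClass_mul (F := F) hk
    obtain ⟨p, hp, h1⟩ := exists_ncard_distanceSphere_one hk t
    -- The 1 counts t itself; no vertex is farther than 2.
    have hsum : (distanceSphere t 1).ncard + 1 + (distanceSphere t 2).ncard =
        (involutionClass F 4 k).ncard := by
      rw [distanceSphere_one, distanceSphere_two hX,
        Set.ncard_sdiff_singleton_add_one (show t ∈ {x : involutionClass F 4 k |
          Commute (t : GL (Fin 4) F) x} from Commute.refl _), Set.ncard_add_ncard_compl,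
        Nat.card_coe_set_eq]
    rw [← hsum] at htotal
    simp only [hq] at htotal h1
    by_cases h2 : (2 : F) = 0
    · rw [ncard_involutionPairs_of_two_eq_zero h2, hq] at htotal
      rw [ncard_orthogonalPairs_of_two_eq_zero h2 hp, if_pos (two_eq_zero_iff_ringChar.1 h2), hq] at h1
      rw [if_pos (two_eq_zero_iff_ringChar.1 h2), if_pos (two_eq_zero_iff_ringChar.1 h2)]
      have hle : q ≤ q ^ 3 := Nat.le_self_pow (by norm_num) q
      -- The inequalities make the truncated subtractions genuine; the counts are then compared
      -- after cancelling q - 1.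
      zify [hpow 4, hpow 3, hpow 2, hq1.le, hle] at htotal h1
      have e1 : ((distanceSphere t 1).ncard : ℤ) = (q : ℤ) ^ 4 + 2 * q ^ 3 - q ^ 2 - q - 2 :=
        mul_right_cancel₀ hq0 (by linear_combination h1)
      refine ⟨e1, mul_right_cancel₀ hq0 ?_⟩
      rw [e1] at htotal
      linear_combination htotal
    · have h2' : ringChar F ≠ 2 := fun h => h2 (two_eq_zero_iff_ringChar.2 h)
      rw [ncard_involutionPairs_of_two_ne_zero h2, hq] at htotal
      rw [ncard_orthogonalPairs_of_two_ne_zero h2 hp, if_neg h2', hq] at h1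
      rw [if_neg h2', if_neg h2']
      zify [hpow 4, hpow 3, hq1.le] at htotal h1
      have e1 : ((distanceSphere t 1).ncard : ℤ) = (q : ℤ) ^ 4 + q ^ 3 + q ^ 2 :=
        mul_right_cancel₀ hq0 (by linear_combination h1)
      refine ⟨e1, mul_right_cancel₀ hq0 ?_⟩
      rw [e1] at htotal
      linear_combination htotal
  let t₀ : involutionClass F 4 k := ⟨standardInvolution F 4 k, IsConj.refl _⟩
  have : Nonempty (involutionClass F 4 k) := ⟨t₀⟩
  refine ⟨commutingGraph_connected hX, commutingGraph_ediam_eq_two hX (t := t₀) ?_, hcount⟩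
  refine Set.nonempty_of_ncard_ne_zero fun h0 => ?_
  have h := (hcount t₀).2
  rw [h0, Nat.cast_zero] at h
  split_ifs at h
  · have : (0 : ℤ) < (q : ℤ) ^ 3 * ((q : ℤ) ^ 3 + q ^ 2 - 2) := by
      have : (1 : ℤ) < q ^ 2 := by nlinarith
      have : (1 : ℤ) < q ^ 3 := by nlinarith
      exact mul_pos (by linarith) (by linarith)
    linarith
  · have : (1 : ℤ) < q ^ 2 := by nlinarith
    have : (1 : ℤ) < q ^ 3 := by nlinarith
    have : (q : ℤ) ^ 2 < q ^ 5 := by nlinarith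
    have : (1 : ℤ) < q ^ 6 := by nlinarith
    linarith
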